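/- Let $0<q<1$, $[n]_q=\frac{1-q^n}{1-q}$ and, for $k\ge 0$, $\phi_k(x;1)=\prod_{j=0}^{k-1}(1-2xq^j+q^{2j})$. For an entire function $f$ put $M(r;f)=\max_{|x|=r}|f(x)|$ and let $$\sigma_{\log}(f)=\limsup_{r\to\infty}\frac{\ln^+\ln^+M(r;f)}{\ln\ln r}$$ be its logarithmic order. Let $f(x)=\sum_{k=0}^\infty a_k\phi_k(x;1)$ $(x\in\mathbb{C})$ be a transcendental entire function with $\sigma_{\log}(f)<2$, and for $r>0$ let $$\mu_q(r;f)=\max_{n\ge 0}\max_{|x|=r}|a_n\phi_n(x;1)|,\qquad \nu_q(r;f)=\max\Big\{n\ge 0:\max_{|x|=r}|a_n\phi_n(x;1)|=\mu_q(r;f)\Big\}.$$ Let $\delta\in(0,1)$. Then there exists a measurable set $E\subseteq[1,\infty)$ of zero logarithmic density, that is, $$\limsup_{r\to\infty}\frac{1}{\ln r}\int_{E\cap[1,r]}\frac{dx}{x}=0,$$ such that for all real $h\ge 0$, $\beta>0$ and $\omega\in(0,\beta)$ the series below converges for every $r>0$ and $$\sum_{k\ge 0:\ |k-N|\ge\kappa}q^{-hk}[k]_q^h\,|a_k\phi_k(-r;1)|=o\!\left(\mu_q(r;f)\,q^{-hN}[N]_q^h\,b(N)^{\frac{\omega-1}{2}}\right)$$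 as $r\to\infty$ with $r\in(0,\infty)\setminus E$, where $N=\nu_q(r;f)$, $b(N)=N^{-1+\delta}$, $\kappa=\left[\sqrt{\frac{\beta}{b(N)}\ln\frac{1}{b(N)}}\right]$, $[\,\cdot\,]$ without subscript denotes the integer part, and $[0]_q^0=1$. -/

import Mathlib

open Filter Topology Asymptotics
open scoped ENNReal

noncomputable section

namespace AskeyWilson

/-- The maximum modulus `M(r;f) = max {|f x| : |x| = r}`. -/
def maxModulus (f : ℂ → ℂ) (r : ℝ) : ℝ :=
  sSup ((fun x => ‖f x‖) '' Metric.sphere (0 : ℂ) r)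

/-- The logarithmic order `limsup_{r → ∞} ln⁺ ln⁺ M(r;f) / ln ln r`, an extended real number. -/
def logOrder (f : ℂ → ℂ) : EReal :=
  limsup (fun r : ℝ =>
    ((Real.posLog (Real.posLog (maxModulus f r)) / Real.log (Real.log r) : ℝ) : EReal)) atTop

/-- A transcendental entire function: holomorphic on `ℂ` and not a polynomial function. -/
def IsTranscendentalEntire (f : ℂ → ℂ) : Prop :=
  Differentiable ℂ f ∧ ¬ ∃ p : Polynomial ℂ, ∀ x, f x = p.eval x

/-- The `q`-number `[n]_q = (1 - q ^ n) / (1 - q)`. -/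
def qNumber (q : ℝ) (n : ℕ) : ℝ := (1 - q ^ n) / (1 - q)

/-- The Askey-Wilson basis at the point `1`:
`φ_k(x;1) = (z, 1/z; q)_k = ∏_{j < k} (1 - 2 x q ^ j + q ^ (2 j))`, where `x = (z + 1/z) / 2`. -/
def basis (q : ℝ) (k : ℕ) (x : ℂ) : ℂ :=
  ∏ j ∈ Finset.range k, (1 - 2 * x * (q : ℂ) ^ j + (q : ℂ) ^ (2 * j))

/-- `f(x) = ∑_{k ≥ 0} a_k φ_k(x;1)` for every complex `x`, as a convergent series. -/
def IsExpansion (q : ℝ) (a : ℕ → ℂ) (f : ℂ → ℂ) : Prop :=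
  ∀ x : ℂ, Tendsto (fun n => ∑ k ∈ Finset.range n, a k * basis q k x) atTop (𝓝 (f x))

/-- The maximum of `|a_n φ_n(x;1)|` on the circle `|x| = r`. -/
def termMax (q : ℝ) (a : ℕ → ℂ) (r : ℝ) (n : ℕ) : ℝ :=
  sSup ((fun x => ‖a n * basis q n x‖) '' Metric.sphere (0 : ℂ) r)

/-- The Askey-Wilson maximal term `μ_q(r;f)` of `f = ∑ a_k φ_k(·;1)`. -/
def maxTerm (q : ℝ) (a : ℕ → ℂ) (r : ℝ) : ℝ := ⨆ n : ℕ, termMax q a r n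

/-- The Askey-Wilson central index `ν_q(r;f)` of `f = ∑ a_k φ_k(·;1)`:
the largest index at which the maximal term is attained. -/
def centralIndex (q : ℝ) (a : ℕ → ℂ) (r : ℝ) : ℕ :=
  sSup {n : ℕ | termMax q a r n = maxTerm q a r}

/-- The logarithmic measure `∫_E dx / x` of a set `E` of positive reals. -/
def logMeasure (E : Set ℝ) : ℝ≥0∞ := ∫⁻ x in E, ENNReal.ofReal (1 / x)

/-- The (upper) logarithmic density
`limsup_{r → ∞} logMeasure (E ∩ [1, r]) / ln r` of a set `E ⊆ [1, ∞)`. -/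
def logDensity (E : Set ℝ) : ℝ≥0∞ :=
  limsup (fun r : ℝ => logMeasure (E ∩ Set.Icc 1 r) / ENNReal.ofReal (Real.log r)) atTop

/-- `b(N) = N ^ (-1 + δ)`. -/
def bFun (δ : ℝ) (N : ℕ) : ℝ := (N : ℝ) ^ (-1 + δ)

/-- `κ = [√((β / b(N)) ln (1 / b(N)))]`, the bracket being the integer part. -/
def kappa (δ β : ℝ) (N : ℕ) : ℕ :=
  ⌊Real.sqrt (β / bFun δ N * Real.log (1 / bFun δ N))⌋₊

/-- The indices `k ≥ 0` with `|k - N| ≥ K`. -/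
def farIndices (N K : ℕ) : Set ℕ := {k : ℕ | (K : ℤ) ≤ |(k : ℤ) - (N : ℤ)|}

/-- The weighted term `q ^ (-h k) [k]_q ^ h |a_k φ_k(-r;1)|`; for `h = 0` the weight is `1` for
every `k`, including `k = 0`. -/
def weightedTerm (q : ℝ) (a : ℕ → ℂ) (h r : ℝ) (k : ℕ) : ℝ :=
  q ^ (-(h * (k : ℝ))) * qNumber q k ^ h * ‖a k * basis q k (-(r : ℂ))‖

end AskeyWilson

end

/-!
Write `s = ln r` and `T_k(r) = |a_k| ∏_{j < k} (1 + 2 r q ^ j + q ^ (2 j))`, the maximum of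
`|a_k φ_k|` on `|x| = r`, which is attained at `x = -r`.

The basis polynomials vanish successively at the nodes `x_j = (q ^ j + q ^ (-j)) / 2`, so the
expansion is the Newton interpolation series of `f`. Following the Newton remainders on a large
circle gives `|a_k| ≤ M(R;f) (2 q ^ (-k) / R) ^ k` (`norm_coeff_le`). As the logarithmic order is
less than `2`, the choice `ln R = k ^ (2 / σ)` yields `|a_k| ≤ exp (-k ^ (1 + τ) / 2)` for some
`τ > 1` (`exists_coeff_decay`). Hence the central index, as a function of `s`, is at most
`(3 s) ^ (1 / τ)` (`centralIndex_le`), a power less than one. It is also nondecreasing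
(`centralIndex_mono`), because `T_m / T_n` increases with `r` when `n ≤ m`.

The jumps of the central index are therefore so sparse that the set of `s` within `s ^ γ` of a
jump has density zero for a suitable `γ > 0` (`logDensity_jumpSet`); this set is the exceptional
set, and it depends on neither `h`, `β`, `ω` nor `δ`. For any other `s`, the index `N` is still
the central one at `e ^ (s ± L)`, `L = s ^ γ`. Comparing the terms at `e ^ s` with those at
`e ^ (s ± L)` gives `T_k ≤ (2 e ^ (-L)) ^ |k - N| T_N` as long as `e ^ s q ^ k ≥ 1`
(`termMax_le_pow`), and the remaining terms are small by the decay of the coefficients. As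
`L → ∞`, this absorbs the weight `q ^ (-h (k - N))` and leaves `exp (-|k - N|)`
(`eventually_weightedTerm_le`). So the tail is of order `exp (-κ / 2)`, and since `κ` exceeds a
power of `N` this beats every power of `b(N)` (`eventually_exp_neg_kappa_le`).
-/

namespace AskeyWilson

/-! ### The Askey-Wilson basis on circles -/

/-- The maximum of `|φ_k(x;1)|` on the circle `|x| = r`, attained at `x = -r`. -/
noncomputable def basisMax (q : ℝ) (k : ℕ) (r : ℝ) : ℝ :=
  ∏ j ∈ Finset.range k, (1 + 2 * r * q ^ j + q ^ (2 * j))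

variable {q r : ℝ} {a : ℕ → ℂ}

lemma factor_pos (hq : 0 < q) (hr : 0 ≤ r) (j : ℕ) : 0 < 1 + 2 * r * q ^ j + q ^ (2 * j) := by
  positivity

lemma basisMax_pos (hq : 0 < q) (hr : 0 ≤ r) (k : ℕ) : 0 < basisMax q k r :=
  Finset.prod_pos fun j _ => factor_pos hq hr j

lemma norm_basis_neg (hq : 0 < q) (hr : 0 ≤ r) (k : ℕ) :
    ‖basis q k (-(r : ℂ))‖ = basisMax q k r := by
  have h : basis q k (-(r : ℂ)) = ((basisMax q k r : ℝ) : ℂ) := by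
    unfold basis basisMax
    push_cast
    exact Finset.prod_congr rfl fun j _ => by ring
  rw [h, Complex.norm_real, Real.norm_of_nonneg (basisMax_pos hq hr k).le]

lemma norm_basis_le (hq : 0 < q) {x : ℂ} (hx : ‖x‖ = r) (k : ℕ) :
    ‖basis q k x‖ ≤ basisMax q k r := by
  unfold basis basisMax
  rw [norm_prod]
  refine Finset.prod_le_prod (fun _ _ => norm_nonneg _) fun j _ => ?_
  calc ‖1 - 2 * x * (q : ℂ) ^ j + (q : ℂ) ^ (2 * j)‖
      ≤ ‖(1 : ℂ)‖ + ‖2 * x * (q : ℂ) ^ j‖ + ‖(q : ℂ) ^ (2 * j)‖ :=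
        (norm_add_le _ _).trans (add_le_add_left (norm_sub_le _ _) _)
    _ = 1 + 2 * r * q ^ j + q ^ (2 * j) := by
        simp [hx, abs_of_pos hq]

lemma termMax_eq (hq : 0 < q) (hr : 0 ≤ r) (n : ℕ) :
    termMax q a r n = ‖a n‖ * basisMax q n r := by
  refine IsGreatest.csSup_eq ⟨⟨-(r : ℂ), ?_, ?_⟩, ?_⟩
  · simp [abs_of_nonneg hr]
  · simp only [norm_mul, norm_basis_neg hq hr]
  · rintro _ ⟨x, hx, rfl⟩
    simp only [norm_mul]
    exact mul_le_mul_of_nonneg_left (norm_basis_le hq (by simpa using hx) n) (norm_nonneg _)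

lemma termMax_nonneg (hq : 0 < q) (hr : 0 ≤ r) (n : ℕ) : 0 ≤ termMax q a r n := by
  rw [termMax_eq hq hr]
  exact mul_nonneg (norm_nonneg _) (basisMax_pos hq hr n).le

lemma basisMax_le (hq : 0 < q) (hq1 : q < 1) (hr : 0 ≤ r) (k : ℕ) :
    basisMax q k r ≤ (2 + 2 * r) ^ k := by
  unfold basisMax
  refine (Finset.prod_le_prod (g := fun _ => 2 + 2 * r)
    (fun j _ => (factor_pos hq hr j).le) fun j _ => ?_).trans (by simp)
  have h1 : q ^ j ≤ 1 := pow_le_one₀ hq.le hq1.le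
  have h2 : q ^ (2 * j) ≤ 1 := pow_le_one₀ hq.le hq1.le
  nlinarith

lemma one_le_basisMax (hq : 0 < q) (hr : 0 ≤ r) (k : ℕ) : 1 ≤ basisMax q k r := by
  unfold basisMax
  refine (Finset.prod_le_prod (f := fun _ => (1 : ℝ)) (fun _ _ => zero_le_one)
    fun j _ => ?_).trans' (by simp)
  have : 0 ≤ 2 * r * q ^ j + q ^ (2 * j) := by positivity
  linarith

/-! ### Newton interpolation at the zeros of the basis -/

/-- The zero `(q ^ k + q ^ (-k)) / 2` of the `k`-th factor of the Askey-Wilson basis. -/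
noncomputable def node (q : ℝ) (k : ℕ) : ℂ := ((q : ℂ) ^ k + ((q : ℂ) ^ k)⁻¹) / 2

lemma factor_eq (hq : 0 < q) (k : ℕ) (x : ℂ) :
    1 - 2 * x * (q : ℂ) ^ k + (q : ℂ) ^ (2 * k) = -(2 * (q : ℂ) ^ k) * (x - node q k) := by
  have h : (q : ℂ) ^ k ≠ 0 := pow_ne_zero _ (by exact_mod_cast hq.ne')
  unfold node
  field_simp
  ring

lemma basis_succ (k : ℕ) (x : ℂ) : basis q (k + 1) x =
    basis q k x * (1 - 2 * x * (q : ℂ) ^ k + (q : ℂ) ^ (2 * k)) :=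
  Finset.prod_range_succ _ _

lemma basis_node_eq_zero (hq : 0 < q) {j k : ℕ} (h : j < k) : basis q k (node q j) = 0 :=
  Finset.prod_eq_zero (Finset.mem_range.2 h) (by rw [factor_eq hq]; simp)

lemma basis_node_ne_zero (hq : 0 < q) (hq1 : q < 1) (k : ℕ) : basis q k (node q k) ≠ 0 := by
  refine Finset.prod_ne_zero_iff.2 fun j hj => ?_
  have hj : j < k := Finset.mem_range.1 hj
  have hk : (q : ℂ) ^ k ≠ 0 := pow_ne_zero _ (by exact_mod_cast hq.ne')
  -- With `z = q ^ k` the factor is `(1 - z q ^ j) (1 - q ^ j / z)`.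
  have e : 1 - 2 * node q k * (q : ℂ) ^ j + (q : ℂ) ^ (2 * j) =
      (((1 - q ^ k * q ^ j) * (q ^ k - q ^ j) : ℝ) : ℂ) / (q : ℂ) ^ k := by
    unfold node
    push_cast
    field_simp
    ring
  rw [e]
  refine div_ne_zero (Complex.ofReal_ne_zero.2 (mul_ne_zero ?_ ?_)) hk
  · have h1 : q ^ k < 1 := pow_lt_one₀ hq.le hq1 (by omega)
    have h2 : q ^ j ≤ 1 := pow_le_one₀ hq.le hq1.le
    have h3 : 0 < q ^ j := by positivity
    nlinarith
  · exact (sub_neg.2 (pow_lt_pow_right_of_lt_one₀ hq hq1 hj)).ne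

lemma norm_node_le (hq : 0 < q) (hq1 : q < 1) {R : ℝ} {k : ℕ} (hR : 1 ≤ R * q ^ k) :
    ‖node q k‖ ≤ R := by
  have hkpos : 0 < q ^ k := by positivity
  have e : node q k = (((q ^ k + (q ^ k)⁻¹) / 2 : ℝ) : ℂ) := by
    unfold node; push_cast; rfl
  rw [e, Complex.norm_real, Real.norm_of_nonneg (by positivity)]
  have h1 : (q ^ k)⁻¹ ≤ R := (inv_le_iff_one_le_mul₀ hkpos).2 hR
  have h2 : 1 ≤ (q ^ k)⁻¹ := (one_le_inv₀ hkpos).2 (pow_le_one₀ hq.le hq1.le)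
  have h3 : q ^ k ≤ 1 := pow_le_one₀ hq.le hq1.le
  linarith

lemma IsExpansion.apply_node (hq : 0 < q) {f : ℂ → ℂ} (ha : IsExpansion q a f) (k : ℕ) :
    f (node q k) = ∑ m ∈ Finset.range (k + 1), a m * basis q m (node q k) := by
  refine tendsto_nhds_unique (ha (node q k)) (tendsto_const_nhds.congr' ?_)
  filter_upwards [eventually_ge_atTop (k + 1)] with n hn
  refine Finset.sum_subset (Finset.range_subset_range.2 hn) fun m _ hm => ?_
  rw [basis_node_eq_zero hq (by simpa using hm), mul_zero]

/-- The `k`-th remainder of the Newton interpolation of `f` at the zeros of the basis: an entire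
function `g` with `f = ∑_{m < k} a_m φ_m + φ_k g`. Each step divides the difference to the value
at the next node by a factor of modulus at least `R q ^ K`, which gives the bound on `|x| = R`. -/
lemma exists_newton_remainder (hq : 0 < q) (hq1 : q < 1) {f : ℂ → ℂ} (hf : Differentiable ℂ f)
    (ha : IsExpansion q a f) {R M : ℝ} {K : ℕ} (hR : 2 ≤ R * q ^ K)
    (hM : ∀ x : ℂ, ‖x‖ = R → ‖f x‖ ≤ M) (k : ℕ) (hk : k ≤ K) :
    ∃ g : ℂ → ℂ, Differentiable ℂ g ∧
      (∀ x, f x = ∑ m ∈ Finset.range k, a m * basis q m x + basis q k x * g x) ∧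
      (∀ x : ℂ, ‖x‖ ≤ R → ‖g x‖ ≤ M * (2 / (R * q ^ K)) ^ k) ∧ g (node q k) = a k := by
  have hRpos : 0 < R := pos_of_mul_pos_left (by linarith) (by positivity)
  have hball : ∀ (g : ℂ → ℂ) (C : ℝ), Differentiable ℂ g →
      (∀ x : ℂ, ‖x‖ = R → ‖g x‖ ≤ C) → ∀ x : ℂ, ‖x‖ ≤ R → ‖g x‖ ≤ C := by
    intro g C hg hC x hx
    refine Complex.norm_le_of_forall_mem_frontier_norm_le (U := Metric.ball (0 : ℂ) R)
      Metric.isBounded_ball hg.diffContOnCl (fun z hz => hC z ?_) ?_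
    · rw [frontier_ball _ hRpos.ne'] at hz
      simpa using hz
    · rw [closure_ball _ hRpos.ne']
      simpa using hx
  -- The last conclusion is a consequence of the second one.
  have hval : ∀ (k : ℕ) (g : ℂ → ℂ),
      (∀ x, f x = ∑ m ∈ Finset.range k, a m * basis q m x + basis q k x * g x) →
      g (node q k) = a k := by
    intro k g hg
    have h := hg (node q k)
    rw [ha.apply_node hq, Finset.sum_range_succ] at h
    have h' := add_left_cancel h
    rw [mul_comm] at h'
    exact (mul_left_cancel₀ (basis_node_ne_zero hq hq1 k) h').symm
  induction k with
  | zero =>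
    have h0 : ∀ x, f x = ∑ m ∈ Finset.range 0, a m * basis q m x + basis q 0 x * f x := by
      intro x; simp [basis]
    exact ⟨f, hf, h0, by simpa using hball f M hf hM, hval 0 f h0⟩
  | succ k ih =>
    obtain ⟨g, hgd, hg, hgb, hga⟩ := ih (by omega)
    set c : ℂ := -(2 * (q : ℂ) ^ k)
    have hc : c ≠ 0 :=
      neg_ne_zero.2 (mul_ne_zero two_ne_zero (pow_ne_zero _ (by exact_mod_cast hq.ne')))
    have hnew : ∀ x, (1 - 2 * x * (q : ℂ) ^ k + (q : ℂ) ^ (2 * k)) *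
        (c⁻¹ * dslope g (node q k) x) = g x - g (node q k) := by
      intro x
      have := sub_smul_dslope g (node q k) x
      rw [factor_eq hq, ← this, smul_eq_mul]
      change c * (x - node q k) * (c⁻¹ * dslope g (node q k) x) = _
      field_simp
    have hd : Differentiable ℂ fun x => c⁻¹ * dslope g (node q k) x := by
      refine Differentiable.const_mul ?_ _
      rw [← differentiableOn_univ]
      exact (Complex.differentiableOn_dslope univ_mem).2 hgd.differentiableOn
    have hrep : ∀ x, f x = ∑ m ∈ Finset.range (k + 1), a m * basis q m x +
        basis q (k + 1) x * (c⁻¹ * dslope g (node q k) x) := by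
      intro x
      rw [basis_succ, mul_assoc, hnew, Finset.sum_range_succ, hg x, hga]
      ring
    refine ⟨_, hd, hrep, hball _ _ hd fun x hx => ?_, hval _ _ hrep⟩
    have hkK : q ^ K ≤ q ^ k := pow_le_pow_of_le_one hq.le hq1.le (by omega)
    have hnode : ‖node q k‖ ≤ R := norm_node_le hq hq1 (by nlinarith)
    have hfac : R * q ^ K ≤ ‖1 - 2 * x * (q : ℂ) ^ k + (q : ℂ) ^ (2 * k)‖ := by
      have h1 : ‖2 * x * (q : ℂ) ^ k‖ = 2 * R * q ^ k := by simp [hx, abs_of_pos hq]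
      have h2 : ‖(1 : ℂ) + (q : ℂ) ^ (2 * k)‖ ≤ 2 := by
        refine (norm_add_le _ _).trans ?_
        have : q ^ (2 * k) ≤ 1 := pow_le_one₀ hq.le hq1.le
        simp only [norm_one, norm_pow, Complex.norm_real, Real.norm_of_nonneg hq.le]
        linarith
      have h3 := norm_sub_norm_le (2 * x * (q : ℂ) ^ k) (1 + (q : ℂ) ^ (2 * k))
      rw [norm_sub_rev] at h3
      have e : 1 + (q : ℂ) ^ (2 * k) - 2 * x * (q : ℂ) ^ k =
          1 - 2 * x * (q : ℂ) ^ k + (q : ℂ) ^ (2 * k) := by ring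
      rw [e] at h3
      nlinarith
    have hn := congrArg norm (hnew x)
    rw [norm_mul] at hn
    have hup : ‖g x - g (node q k)‖ ≤ 2 * (M * (2 / (R * q ^ K)) ^ k) := by
      have := norm_sub_le (g x) (g (node q k))
      linarith [hgb x hx.le, hgb _ hnode]
    have hB : 0 < R * q ^ K := by linarith
    rw [pow_succ, ← mul_assoc, mul_div_assoc', le_div_iff₀ hB]
    have := mul_le_mul_of_nonneg_right hfac (norm_nonneg (c⁻¹ * dslope g (node q k) x))
    linarith

lemma norm_coeff_le (hq : 0 < q) (hq1 : q < 1) {f : ℂ → ℂ} (hf : Differentiable ℂ f)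
    (ha : IsExpansion q a f) {R : ℝ} {k : ℕ} (hR : 2 ≤ R * q ^ k) :
    ‖a k‖ ≤ maxModulus f R * (2 / (R * q ^ k)) ^ k := by
  have hRpos : 0 < R := pos_of_mul_pos_left (by linarith) (by positivity)
  have hM : ∀ x : ℂ, ‖x‖ = R → ‖f x‖ ≤ maxModulus f R := by
    intro x hx
    refine le_csSup ?_ ⟨x, by simpa using hx, rfl⟩
    exact ((isCompact_sphere (0 : ℂ) R).image hf.continuous.norm).bddAbove
  obtain ⟨g, -, -, hgb, hga⟩ := exists_newton_remainder hq hq1 hf ha hR hM k le_rfl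
  rw [← hga]
  exact hgb _ (norm_node_le hq hq1 (by linarith))

/-! ### Decay of the coefficients -/

lemma eventually_quadratic_le {τ : ℝ} (hτ : 1 < τ) (A : ℝ) :
    ∀ᶠ k : ℕ in atTop, A * (k : ℝ) ^ 2 ≤ (k : ℝ) ^ (1 + τ) / 2 := by
  have h := (tendsto_rpow_atTop (sub_pos.2 hτ)).comp tendsto_natCast_atTop_atTop
  filter_upwards [h.eventually_ge_atTop (2 * A), eventually_gt_atTop 0] with k hk h0
  have h0 : (0 : ℝ) < k := by exact_mod_cast h0
  have e : (k : ℝ) ^ (1 + τ) = (k : ℝ) ^ 2 * (k : ℝ) ^ (τ - 1) := by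
    rw [← Real.rpow_natCast, ← Real.rpow_add h0]
    congr 1
    push_cast
    ring
  have hk' : 2 * A ≤ (k : ℝ) ^ (τ - 1) := hk
  rw [e]
  nlinarith [sq_nonneg (k : ℝ), mul_le_mul_of_nonneg_left hk' (sq_nonneg (k : ℝ))]

lemma pow_eq_exp (hq : 0 < q) (k : ℕ) : q ^ k = Real.exp (-(k * -Real.log q)) := by
  rw [mul_neg, neg_neg, Real.exp_nat_mul, Real.exp_log hq]

/-- The strict bound on the logarithmic order leaves room for an exponent `σ < 2`, which may be
enlarged to be positive. -/
lemma exists_maxModulus_le {f : ℂ → ℂ} (hord : logOrder f < 2) :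
    ∃ σ : ℝ, 0 < σ ∧ σ < 2 ∧
      ∀ᶠ r : ℝ in atTop, maxModulus f r ≤ Real.exp (Real.log r ^ σ) := by
  obtain ⟨s, hs, hs2⟩ := EReal.lt_iff_exists_real_btwn.1 hord
  have hs2 : s < 2 := EReal.coe_lt_coe_iff.1 hs2
  refine ⟨max s (3 / 2), lt_max_of_lt_right (by norm_num), max_lt hs2 (by norm_num), ?_⟩
  have hlog := Real.tendsto_log_atTop
  filter_upwards [eventually_lt_of_limsup_lt hs, hlog.eventually_gt_atTop 1] with r hr h1
  have hr : Real.posLog (Real.posLog (maxModulus f r)) / Real.log (Real.log r) < s := by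
    exact_mod_cast hr
  have hll : 0 < Real.log (Real.log r) := Real.log_pos h1
  rw [div_lt_iff₀ hll] at hr
  have hexp : ∀ y : ℝ, y ≤ Real.exp (Real.posLog y) := fun y => by
    rcases le_or_gt y 0 with hy | hy
    · exact hy.trans (Real.exp_pos _).le
    · calc y = Real.exp (Real.log y) := (Real.exp_log hy).symm
        _ ≤ _ := Real.exp_le_exp.2 (le_max_right _ _)
  refine (hexp _).trans (Real.exp_le_exp.2 ((hexp _).trans ?_))
  rw [Real.rpow_def_of_pos (by linarith), Real.exp_le_exp]
  nlinarith [mul_le_mul_of_nonneg_left (le_max_left s (3 / 2)) hll.le]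

/-- The bound `|a_k| ≤ M(R;f) (2 q ^ (-k) / R) ^ k`, taken at `ln R = k ^ (2 / σ)`, where
`ln M(R;f) ≤ (ln R) ^ σ = k ^ 2`. -/
lemma exists_coeff_decay (hq : 0 < q) (hq1 : q < 1) {f : ℂ → ℂ} (hf : Differentiable ℂ f)
    (hord : logOrder f < 2) (ha : IsExpansion q a f) :
    ∃ τ : ℝ, 1 < τ ∧ ∀ᶠ k : ℕ in atTop, ‖a k‖ ≤ Real.exp (-((k : ℝ) ^ (1 + τ) / 2)) := by
  obtain ⟨σ, hσ0, hσ2, hM⟩ := exists_maxModulus_le hord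
  have hτ : 1 < 2 / σ := (one_lt_div hσ0).2 hσ2
  refine ⟨2 / σ, hτ, ?_⟩
  set τ := 2 / σ
  set l := -Real.log q
  have hl : 0 < l := neg_pos.2 (Real.log_neg hq hq1)
  have hlim : Tendsto (fun k : ℕ => Real.exp ((k : ℝ) ^ τ)) atTop atTop :=
    Real.tendsto_exp_atTop.comp
      ((tendsto_rpow_atTop (by linarith)).comp tendsto_natCast_atTop_atTop)
  filter_upwards [hlim.eventually hM, eventually_quadratic_le hτ (l + 2),
    eventually_ge_atTop 1] with k hk hA h1
  have h1 : (1 : ℝ) ≤ k := by exact_mod_cast h1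
  have hqk : q ^ k = Real.exp (-(k * l)) := pow_eq_exp hq k
  have e : (k : ℝ) ^ (1 + τ) = k * (k : ℝ) ^ τ := by
    rw [Real.rpow_add (by linarith), Real.rpow_one]
  have hlog2 : Real.log 2 ≤ 1 := by linarith [Real.log_two_lt_d9]
  have hexp2 : (2 : ℝ) = Real.exp (Real.log 2) := (Real.exp_log two_pos).symm
  have hbig : 2 * (l + 2) * k ≤ (k : ℝ) ^ τ := by
    rw [e] at hA
    refine le_of_mul_le_mul_left ?_ (by linarith : (0 : ℝ) < k)
    linarith
  have hR : 2 ≤ Real.exp ((k : ℝ) ^ τ) * q ^ k := by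
    rw [hqk, ← Real.exp_add]
    nth_rewrite 1 [hexp2]
    rw [Real.exp_le_exp]
    nlinarith
  refine (norm_coeff_le hq hq1 hf ha hR).trans ?_
  have hS : Real.log (Real.exp ((k : ℝ) ^ τ)) ^ σ = (k : ℝ) ^ 2 := by
    rw [Real.log_exp, ← Real.rpow_mul (by linarith), div_mul_cancel₀ _ hσ0.ne']
    norm_num
  rw [hS] at hk
  have hpow : (2 / (Real.exp ((k : ℝ) ^ τ) * q ^ k)) ^ k =
      Real.exp (k * (Real.log 2 - ((k : ℝ) ^ τ - k * l))) := by
    rw [hqk, ← Real.exp_add, Real.exp_nat_mul, Real.exp_sub, Real.exp_log two_pos, sub_eq_add_neg]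
  rw [hpow]
  refine (mul_le_mul_of_nonneg_right hk (Real.exp_pos _).le).trans ?_
  rw [← Real.exp_add, Real.exp_le_exp]
  rw [e] at hA ⊢
  nlinarith

/-- The coefficients decay faster than every Gaussian `exp (-A k ^ 2)`. -/
def SuperGaussianDecay (a : ℕ → ℂ) : Prop :=
  ∀ A : ℝ, ∀ᶠ k : ℕ in atTop, ‖a k‖ ≤ Real.exp (-(A * (k : ℝ) ^ 2))

lemma superGaussianDecay_of_le {τ : ℝ} (hτ : 1 < τ)
    (h : ∀ᶠ k : ℕ in atTop, ‖a k‖ ≤ Real.exp (-((k : ℝ) ^ (1 + τ) / 2))) :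
    SuperGaussianDecay a := fun A => by
  filter_upwards [h, eventually_quadratic_le hτ A] with k hk hA
  exact hk.trans (Real.exp_le_exp.2 (neg_le_neg hA))

lemma SuperGaussianDecay.summable_mul_pow (hd : SuperGaussianDecay a) {C : ℝ} (hC : 0 < C) :
    Summable fun k => ‖a k‖ * C ^ k := by
  refine Summable.of_norm_bounded_eventually_nat Real.summable_exp_neg_nat ?_
  filter_upwards [hd (|Real.log C| + 1), eventually_ge_atTop 1] with k hk h1
  have h1 : (1 : ℝ) ≤ k := by exact_mod_cast h1
  have e : C ^ k = Real.exp (k * Real.log C) := by rw [Real.exp_nat_mul, Real.exp_log hC]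
  rw [Real.norm_of_nonneg (by positivity), e]
  refine (mul_le_mul_of_nonneg_right hk (Real.exp_pos _).le).trans ?_
  rw [← Real.exp_add, Real.exp_le_exp]
  have h2 := le_abs_self (Real.log C)
  have h3 := abs_nonneg (Real.log C)
  have h4 : (k : ℝ) ≤ (k : ℝ) ^ 2 := by nlinarith
  nlinarith [mul_le_mul_of_nonneg_left h4 h3,
    mul_le_mul_of_nonneg_left h2 (by linarith : (0 : ℝ) ≤ k)]

/-- A transcendental function has infinitely many nonzero coefficients, as a finite expansion is
a polynomial. -/
lemma exists_coeff_ne_zero {f : ℂ → ℂ} (hf : IsTranscendentalEntire f) (ha : IsExpansion q a f)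
    (n : ℕ) : ∃ k, n < k ∧ a k ≠ 0 := by
  by_contra! h
  refine hf.2 ⟨∑ k ∈ Finset.range (n + 1), Polynomial.C (a k) * ∏ j ∈ Finset.range k,
    (1 - 2 * Polynomial.X * Polynomial.C ((q : ℂ) ^ j) + Polynomial.C ((q : ℂ) ^ (2 * j))),
    fun x => ?_⟩
  have hx : f x = ∑ k ∈ Finset.range (n + 1), a k * basis q k x := by
    refine tendsto_nhds_unique (ha x) (tendsto_const_nhds.congr' ?_)
    filter_upwards [eventually_ge_atTop (n + 1)] with m hm
    refine Finset.sum_subset (Finset.range_subset_range.2 hm) fun k _ hk => ?_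
    rw [h k (by simpa using hk), zero_mul]
  rw [hx]
  simp [Polynomial.eval_finsetSum, Polynomial.eval_prod, basis]

lemma qNumber_nonneg (hq : 0 < q) (hq1 : q < 1) (n : ℕ) : 0 ≤ qNumber q n :=
  div_nonneg (sub_nonneg.2 (pow_le_one₀ hq.le hq1.le)) (by linarith)

lemma qNumber_le (hq : 0 < q) (hq1 : q < 1) (n : ℕ) : qNumber q n ≤ 1 / (1 - q) :=
  div_le_div_of_nonneg_right (by linarith [pow_pos hq n]) (by linarith)

lemma one_le_qNumber (hq : 0 < q) (hq1 : q < 1) {n : ℕ} (hn : n ≠ 0) : 1 ≤ qNumber q n := by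
  rw [qNumber, one_le_div (by linarith)]
  linarith [pow_le_of_le_one hq.le hq1.le hn]

lemma weightedTerm_eq (hq : 0 < q) (hr : 0 ≤ r) (h : ℝ) (k : ℕ) :
    weightedTerm q a h r k = q ^ (-(h * (k : ℝ))) * qNumber q k ^ h * termMax q a r k := by
  rw [weightedTerm, termMax_eq hq hr, norm_mul, norm_basis_neg hq hr]

lemma weightedTerm_nonneg (hq : 0 < q) (hq1 : q < 1) (h r : ℝ) (k : ℕ) :
    0 ≤ weightedTerm q a h r k :=
  mul_nonneg (mul_nonneg (Real.rpow_nonneg hq.le _)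
    (Real.rpow_nonneg (qNumber_nonneg hq hq1 k) _)) (norm_nonneg _)

lemma termMax_le (hq : 0 < q) (hq1 : q < 1) (hr : 0 ≤ r) (k : ℕ) :
    termMax q a r k ≤ ‖a k‖ * (2 + 2 * r) ^ k := by
  rw [termMax_eq hq hr]
  exact mul_le_mul_of_nonneg_left (basisMax_le hq hq1 hr k) (norm_nonneg _)

lemma summable_weightedTerm (hq : 0 < q) (hq1 : q < 1) (hd : SuperGaussianDecay a) {h : ℝ}
    (hh : 0 ≤ h) (hr : 0 ≤ r) : Summable (weightedTerm q a h r) := by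
  have hC : 0 < q ^ (-h) * (2 + 2 * r) := by positivity
  refine Summable.of_nonneg_of_le (weightedTerm_nonneg hq hq1 h r) (fun k => ?_)
    ((hd.summable_mul_pow hC).mul_left ((1 / (1 - q)) ^ h))
  have e : q ^ (-(h * (k : ℝ))) = (q ^ (-h)) ^ k := by
    rw [← neg_mul, Real.rpow_mul_natCast hq.le]
  rw [weightedTerm_eq hq hr, e, mul_pow]
  have h1 : qNumber q k ^ h ≤ (1 / (1 - q)) ^ h :=
    Real.rpow_le_rpow (qNumber_nonneg hq hq1 k) (qNumber_le hq hq1 k) hh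
  have h2 := termMax_le (a := a) hq hq1 hr k
  have h3 : 0 ≤ (q ^ (-h)) ^ k := by positivity
  have h4 := mul_le_mul h1 h2 (termMax_nonneg hq hr k)
    (Real.rpow_nonneg (one_div_nonneg.2 (by linarith)) h)
  nlinarith [mul_le_mul_of_nonneg_left h4 h3]

/-! ### The central index -/

lemma tendsto_termMax (hq : 0 < q) (hq1 : q < 1) (hd : SuperGaussianDecay a) (hr : 0 ≤ r) :
    Tendsto (termMax q a r) atTop (𝓝 0) :=
  (Summable.of_nonneg_of_le (termMax_nonneg hq hr) (termMax_le hq hq1 hr)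
    (hd.summable_mul_pow (by positivity))).tendsto_atTop_zero

/-- The maximal term is attained at the central index, and at no larger index. -/
lemma centralIndex_spec (hq : 0 < q) (hq1 : q < 1) (hd : SuperGaussianDecay a)
    (hne : ∃ k, a k ≠ 0) (hr : 0 ≤ r) :
    termMax q a r (centralIndex q a r) = maxTerm q a r ∧
      (∀ n, termMax q a r n ≤ maxTerm q a r) ∧
      ∀ n, centralIndex q a r < n → termMax q a r n < maxTerm q a r := by
  obtain ⟨k, hk⟩ := hne
  have hpos : 0 < termMax q a r k := by
    rw [termMax_eq hq hr]
    exact mul_pos (norm_pos_iff.2 hk) (basisMax_pos hq hr k)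
  obtain ⟨M, hM⟩ := eventually_atTop.1
    ((tendsto_termMax hq hq1 hd hr).eventually (gt_mem_nhds hpos))
  have hkM : k < M := by
    by_contra! h
    exact lt_irrefl _ (hM k h)
  obtain ⟨m, -, hm⟩ := Finset.exists_max_image (Finset.range M) (termMax q a r)
    ⟨k, Finset.mem_range.2 hkM⟩
  have hkm := hm k (Finset.mem_range.2 hkM)
  have hle : ∀ n, termMax q a r n ≤ termMax q a r m := fun n => by
    rcases lt_or_ge n M with h | h
    · exact hm n (Finset.mem_range.2 h)
    · exact (hM n h).le.trans hkm
  have hmax : termMax q a r m = maxTerm q a r :=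
    le_antisymm (le_ciSup (f := termMax q a r) ⟨_, Set.forall_mem_range.2 hle⟩ m) (ciSup_le hle)
  have hbdd : BddAbove {n | termMax q a r n = maxTerm q a r} := by
    refine ⟨M, fun n hn => ?_⟩
    by_contra! h
    have := (hM n h.le).trans_le hkm
    have hn' : termMax q a r n = maxTerm q a r := hn
    linarith
  refine ⟨Nat.sSup_mem ⟨m, hmax⟩ hbdd, fun n => hmax ▸ hle n, fun n hn => ?_⟩
  refine lt_of_le_of_ne (hmax ▸ hle n) fun h => ?_
  exact absurd (le_csSup hbdd h) (not_le.2 hn)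

lemma termMax_le_centralIndex (hq : 0 < q) (hq1 : q < 1) (hd : SuperGaussianDecay a)
    (hne : ∃ k, a k ≠ 0) (hr : 0 ≤ r) (n : ℕ) :
    termMax q a r n ≤ termMax q a r (centralIndex q a r) := by
  obtain ⟨h1, h2, -⟩ := centralIndex_spec hq hq1 hd hne hr
  exact h1 ▸ h2 n

lemma basisMax_eq_mul {n m : ℕ} (h : n ≤ m) (r : ℝ) :
    basisMax q m r = basisMax q n r *
      ∏ j ∈ Finset.Ico n m, (1 + 2 * r * q ^ j + q ^ (2 * j)) :=
  (Finset.prod_range_mul_prod_Ico _ h).symm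

/-- If the factors with index in `[n, m)` are at most `c` times as large at `r` as at `r'`, then
the quotient of the basis maxima of index `m` and `n` is at most `c ^ (m - n)` times as large. -/
lemma basisMax_mul_le (hq : 0 < q) {n m : ℕ} (hnm : n ≤ m) {r' c : ℝ} (hr : 0 ≤ r)
    (hr' : 0 ≤ r') (h : ∀ j, n ≤ j → j < m →
      1 + 2 * r * q ^ j + q ^ (2 * j) ≤ c * (1 + 2 * r' * q ^ j + q ^ (2 * j))) :
    basisMax q m r * basisMax q n r' ≤ c ^ (m - n) * (basisMax q n r * basisMax q m r') := by
  have hp : ∏ j ∈ Finset.Ico n m, (1 + 2 * r * q ^ j + q ^ (2 * j)) ≤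
      c ^ (m - n) * ∏ j ∈ Finset.Ico n m, (1 + 2 * r' * q ^ j + q ^ (2 * j)) := by
    rw [← Nat.card_Ico, ← Finset.prod_const, ← Finset.prod_mul_distrib]
    exact Finset.prod_le_prod (fun j _ => (factor_pos hq hr j).le) fun j hj =>
      h j (Finset.mem_Ico.1 hj).1 (Finset.mem_Ico.1 hj).2
  rw [basisMax_eq_mul hnm r, basisMax_eq_mul hnm r']
  have := mul_le_mul_of_nonneg_left hp
    (mul_pos (basisMax_pos hq hr n) (basisMax_pos hq hr' n)).le
  linarith

/-- If the term of index `k ≥ n` does not exceed the term of index `n` at a radius `r'`, it is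
smaller by the factor `c ^ (k - n)` at the radius `r`. -/
lemma termMax_le_of_le (hq : 0 < q) {n k : ℕ} (hnk : n ≤ k) {r' c : ℝ} (hr : 0 ≤ r)
    (hr' : 0 ≤ r') (hc : 0 ≤ c) (h : ∀ j, n ≤ j → j < k →
      1 + 2 * r * q ^ j + q ^ (2 * j) ≤ c * (1 + 2 * r' * q ^ j + q ^ (2 * j)))
    (hle : termMax q a r' k ≤ termMax q a r' n) :
    termMax q a r k ≤ c ^ (k - n) * termMax q a r n := by
  rw [termMax_eq hq hr', termMax_eq hq hr'] at hle
  rw [termMax_eq hq hr, termMax_eq hq hr]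
  have h1 := mul_le_mul_of_nonneg_left (basisMax_mul_le hq hnk hr hr' h) (norm_nonneg (a k))
  have h2 := mul_le_mul_of_nonneg_left hle
    (mul_nonneg (pow_nonneg hc (k - n)) (basisMax_pos hq hr n).le)
  refine le_of_mul_le_mul_right ?_ (basisMax_pos hq hr' n)
  linarith

/-- If the term of index `k ≤ n` does not exceed the term of index `n` at a radius `r'`, it is
smaller by the factor `c ^ (n - k)` at the radius `r`. -/
lemma termMax_le_of_ge (hq : 0 < q) {n k : ℕ} (hkn : k ≤ n) {r' c : ℝ} (hr : 0 ≤ r)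
    (hr' : 0 ≤ r') (hc : 0 ≤ c) (h : ∀ j, k ≤ j → j < n →
      1 + 2 * r' * q ^ j + q ^ (2 * j) ≤ c * (1 + 2 * r * q ^ j + q ^ (2 * j)))
    (hle : termMax q a r' k ≤ termMax q a r' n) :
    termMax q a r k ≤ c ^ (n - k) * termMax q a r n := by
  rw [termMax_eq hq hr', termMax_eq hq hr'] at hle
  rw [termMax_eq hq hr, termMax_eq hq hr]
  have h1 := mul_le_mul_of_nonneg_left (basisMax_mul_le hq hkn hr' hr h) (norm_nonneg (a k))
  have h2 := mul_le_mul_of_nonneg_left hle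
    (mul_nonneg (pow_nonneg hc (n - k)) (basisMax_pos hq hr n).le)
  refine le_of_mul_le_mul_right ?_ (basisMax_pos hq hr' n)
  linarith

lemma centralIndex_mono (hq : 0 < q) (hq1 : q < 1) (hd : SuperGaussianDecay a)
    (hne : ∃ k, a k ≠ 0) {r' : ℝ} (hr : 0 ≤ r) (hrr' : r ≤ r') :
    centralIndex q a r ≤ centralIndex q a r' := by
  have hr' := hr.trans hrr'
  by_contra! hlt
  obtain ⟨h1, -, h3⟩ := centralIndex_spec hq hq1 hd hne hr'
  have h := termMax_le_of_ge (a := a) (c := 1) hq hlt.le hr' hr zero_le_one (fun j _ _ => by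
    have : 0 < q ^ j := by positivity
    nlinarith) (termMax_le_centralIndex hq hq1 hd hne hr _)
  rw [one_pow, one_mul, h1] at h
  exact absurd (h3 _ hlt) (not_lt.2 h)

lemma basisMax_mono (hq : 0 < q) (hr : 0 ≤ r) {n m : ℕ} (h : n ≤ m) :
    basisMax q n r ≤ basisMax q m r := by
  rw [basisMax_eq_mul h]
  refine le_mul_of_one_le_right (basisMax_pos hq hr n).le ?_
  refine (Finset.prod_le_prod (f := fun _ => (1 : ℝ)) (fun _ _ => zero_le_one)
    fun j _ => ?_).trans' (by simp)
  have : 0 ≤ 2 * r * q ^ j + q ^ (2 * j) := by positivity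
  linarith

/-- Every index is eventually overtaken by a larger one with nonzero coefficient. -/
lemma tendsto_centralIndex (hq : 0 < q) (hq1 : q < 1) (hd : SuperGaussianDecay a)
    (hne : ∀ n, ∃ k, n < k ∧ a k ≠ 0) : Tendsto (centralIndex q a) atTop atTop := by
  have key : ∀ n, ∀ᶠ r in atTop, centralIndex q a r ≠ n := fun n => by
    obtain ⟨k, hnk, hk⟩ := hne n
    have hk' : 0 < ‖a k‖ := norm_pos_iff.2 hk
    have hC : 0 < ‖a k‖ * (2 * q ^ n) := by positivity
    filter_upwards [eventually_gt_atTop (‖a n‖ / (‖a k‖ * (2 * q ^ n))),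
      eventually_ge_atTop 0] with r hr hr0 heq
    have h := termMax_le_centralIndex hq hq1 hd ⟨k, hk⟩ hr0 k
    rw [heq, termMax_eq hq hr0, termMax_eq hq hr0] at h
    rw [div_lt_iff₀ hC] at hr
    have h1 := basisMax_mono hq hr0 (Nat.succ_le_of_lt hnk)
    have h2 : basisMax q (n + 1) r =
        basisMax q n r * (1 + 2 * r * q ^ n + q ^ (2 * n)) := Finset.prod_range_succ _ _
    have hP := basisMax_pos hq hr0 n
    have h3 : basisMax q n r * (2 * r * q ^ n) ≤ basisMax q k r := by
      refine le_trans (mul_le_mul_of_nonneg_left ?_ hP.le) (h2 ▸ h1)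
      have : 0 ≤ q ^ (2 * n) := by positivity
      linarith
    have h4 := mul_le_mul_of_nonneg_left h3 hk'.le
    have h5 := mul_lt_mul_of_pos_right hr hP
    linarith
  refine tendsto_atTop.2 fun b => ?_
  have := (Set.finite_lt_nat b).eventually_all (l := (atTop : Filter ℝ))
    (p := fun n r => centralIndex q a r ≠ n)
  filter_upwards [this.2 fun n _ => key n] with r hr
  by_contra! h
  exact hr _ h rfl

lemma two_add_two_mul_exp_le {s : ℝ} (hs : 0 ≤ s) : 2 + 2 * Real.exp s ≤ Real.exp (s + 2) := by
  have e1 : 1 ≤ Real.exp s := Real.one_le_exp hs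
  have e2 : 4 ≤ Real.exp 2 := by
    have := Real.add_one_le_exp (1 : ℝ)
    have e : Real.exp 2 = Real.exp 1 * Real.exp 1 := by rw [← Real.exp_add]; norm_num
    nlinarith
  rw [Real.exp_add]
  nlinarith

/-- At the central index `N` the term is at least a fixed `|a_k| > 0`, while it is at most
`exp (-N ^ (1 + τ) / 2 + N (s + 2))`. This bounds `N ^ τ` by a multiple of `s`. -/
lemma centralIndex_le (hq : 0 < q) (hq1 : q < 1) (hne : ∃ k, a k ≠ 0) {τ : ℝ} (hτ : 1 < τ)
    (hdec : ∀ᶠ k : ℕ in atTop, ‖a k‖ ≤ Real.exp (-((k : ℝ) ^ (1 + τ) / 2))) :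
    ∀ᶠ s : ℝ in atTop, (centralIndex q a (Real.exp s) : ℝ) ≤ (3 * s) ^ (1 / τ) := by
  obtain ⟨k, hk⟩ := hne
  obtain ⟨K, hK⟩ := eventually_atTop.1 hdec
  have hτ0 : 0 < τ := by linarith
  have hlim : Tendsto (fun s : ℝ => (3 * s) ^ (1 / τ)) atTop atTop :=
    (tendsto_rpow_atTop (by positivity)).comp (tendsto_id.const_mul_atTop (by norm_num))
  filter_upwards [hlim.eventually_ge_atTop ((K : ℝ) + 1),
    eventually_ge_atTop (4 + 2 * |Real.log ‖a k‖|)] with s hs hs'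
  set N := centralIndex q a (Real.exp s)
  have habs := neg_abs_le (Real.log ‖a k‖)
  have habs' := abs_nonneg (Real.log ‖a k‖)
  rcases lt_or_ge N (K + 1) with h | h
  · refine le_trans ?_ hs
    exact_mod_cast h.le
  have hN1 : (1 : ℝ) ≤ N := by exact_mod_cast (by omega : 1 ≤ N)
  have hr := (Real.exp_pos s).le
  have h1 := termMax_le_centralIndex hq hq1 (superGaussianDecay_of_le hτ hdec) ⟨k, hk⟩ hr k
  have h2 : ‖a k‖ ≤ termMax q a (Real.exp s) k := by
    rw [termMax_eq hq hr]
    exact le_mul_of_one_le_right (norm_nonneg _) (one_le_basisMax hq hr k)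
  have h3 : (2 + 2 * Real.exp s) ^ N ≤ Real.exp (N * (s + 2)) := by
    rw [Real.exp_nat_mul]
    exact pow_le_pow_left₀ (by positivity) (two_add_two_mul_exp_le (by linarith)) _
  have h4 : ‖a k‖ ≤ Real.exp (-((N : ℝ) ^ (1 + τ) / 2) + N * (s + 2)) := by
    rw [Real.exp_add]
    exact (h2.trans h1).trans ((termMax_le hq hq1 hr N).trans
      (mul_le_mul (hK N (by omega)) h3 (by positivity) (Real.exp_pos _).le))
  have h5 := (Real.log_le_iff_le_exp (norm_pos_iff.2 hk)).2 h4
  rw [Real.rpow_add (by linarith), Real.rpow_one] at h5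
  have h6 : (N : ℝ) ^ τ ≤ 3 * s := by
    refine le_of_mul_le_mul_left ?_ (by linarith : (0 : ℝ) < N)
    nlinarith
  calc (N : ℝ) = ((N : ℝ) ^ τ) ^ (1 / τ) := by
        rw [← Real.rpow_mul (by linarith), mul_one_div_cancel hτ0.ne', Real.rpow_one]
    _ ≤ _ := Real.rpow_le_rpow (by positivity) h6 (by positivity)

/-! ### The exceptional set -/

/-- The radii `r = e ^ s ≥ 1` for which the step function `n` jumps between `s - s ^ γ` and
`s + s ^ γ`. Here `n` is a function of `ln r`. -/
def jumpSet (n : ℝ → ℕ) (γ : ℝ) : Set ℝ :=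
  {r | 1 ≤ r ∧ n (Real.log r + Real.log r ^ γ) ≠ n (Real.log r - Real.log r ^ γ)}

lemma measurableSet_jumpSet {n : ℝ → ℕ} (hn : Monotone n) (γ : ℝ) :
    MeasurableSet (jumpSet n γ) := by
  have hm := hn.measurable
  have h1 : Measurable fun r : ℝ => n (Real.log r + Real.log r ^ γ) := by fun_prop
  have h2 : Measurable fun r : ℝ => n (Real.log r - Real.log r ^ γ) := by fun_prop
  exact measurableSet_Ici.inter (measurableSet_eq_fun h1 h2).compl

lemma logMeasure_Icc_exp {u v : ℝ} (huv : u ≤ v) :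
    logMeasure (Set.Icc (Real.exp u) (Real.exp v)) = ENNReal.ofReal (v - u) := by
  have hle : Real.exp u ≤ Real.exp v := Real.exp_le_exp.2 huv
  have hpos : ∀ x ∈ Set.Icc (Real.exp u) (Real.exp v), 0 < x := fun x hx =>
    (Real.exp_pos u).trans_le hx.1
  have hint : MeasureTheory.IntegrableOn (fun x : ℝ => 1 / x)
      (Set.Icc (Real.exp u) (Real.exp v)) := by
    refine ContinuousOn.integrableOn_Icc (continuousOn_const.div continuousOn_id ?_)
    exact fun x hx => (hpos x hx).ne'
  rw [logMeasure, ← MeasureTheory.ofReal_integral_eq_lintegral_ofReal hint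
    (MeasureTheory.ae_restrict_of_forall_mem measurableSet_Icc fun x hx =>
      (one_div_pos.2 (hpos x hx)).le), MeasureTheory.integral_Icc_eq_integral_Ioc,
    ← intervalIntegral.integral_of_le hle,
    integral_one_div_of_pos (Real.exp_pos u) (Real.exp_pos v), ← Real.exp_sub, Real.log_exp]

/-- Up to `R = e ^ S` the jump set is covered by intervals of logarithmic length `2 S ^ γ`, one
around each of the at most `n (S + S ^ γ)` jumps. -/
lemma logMeasure_jumpSet_le {n : ℝ → ℕ} (hn : Monotone n) {γ R : ℝ} (hγ : 0 < γ) :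
    logMeasure (jumpSet n γ ∩ Set.Icc 1 R) ≤
      ENNReal.ofReal (((n (Real.log R + Real.log R ^ γ) : ℝ) + 1) * (2 * Real.log R ^ γ)) := by
  rcases lt_or_ge R 1 with hR | hR
  · rw [Set.Icc_eq_empty (by linarith), Set.inter_empty]
    simp [logMeasure]
  set S := Real.log R
  set L := S ^ γ
  have hS : 0 ≤ S := Real.log_nonneg hR
  have hL : 0 ≤ L := Real.rpow_nonneg hS γ
  set t : ℕ → ℝ := fun i => sInf {t | i ≤ n t}
  have hcover : jumpSet n γ ∩ Set.Icc 1 R ⊆ ⋃ i : Fin (n (S + L) + 1),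
      Set.Icc (Real.exp (t i - L)) (Real.exp (t i + L)) := by
    rintro r ⟨⟨hr1, hne⟩, -, hrR⟩
    have hr0 : 0 < r := by linarith
    have hs0 : 0 ≤ Real.log r := Real.log_nonneg hr1
    have hsS : Real.log r ≤ S := Real.log_le_log hr0 hrR
    have hl0 : 0 ≤ Real.log r ^ γ := Real.rpow_nonneg hs0 γ
    have hlL : Real.log r ^ γ ≤ L := Real.rpow_le_rpow hs0 hsS hγ.le
    have hlt : n (Real.log r - Real.log r ^ γ) + 1 ≤ n (Real.log r + Real.log r ^ γ) :=
      lt_of_le_of_ne (hn (by linarith)) (Ne.symm hne)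
    have hlow : ∀ x ∈ {t | n (Real.log r - Real.log r ^ γ) + 1 ≤ n t},
        Real.log r - Real.log r ^ γ ≤ x := fun x hx => by
      by_contra! h
      have h1 : n (Real.log r - Real.log r ^ γ) + 1 ≤ n x := hx
      have := hn h.le
      omega
    have h1 : t (n (Real.log r - Real.log r ^ γ) + 1) ≤ Real.log r + Real.log r ^ γ :=
      csInf_le ⟨_, hlow⟩ hlt
    have h2 : Real.log r - Real.log r ^ γ ≤ t (n (Real.log r - Real.log r ^ γ) + 1) :=
      le_csInf ⟨_, hlt⟩ hlow
    have h3 : n (Real.log r + Real.log r ^ γ) ≤ n (S + L) := hn (by linarith)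
    refine Set.mem_iUnion.2 ⟨⟨n (Real.log r - Real.log r ^ γ) + 1, by omega⟩, ?_, ?_⟩
    · rw [← Real.le_log_iff_exp_le hr0]
      dsimp only
      linarith
    · rw [← Real.log_le_iff_le_exp hr0]
      dsimp only
      linarith
  calc logMeasure (jumpSet n γ ∩ Set.Icc 1 R)
      ≤ logMeasure (⋃ i : Fin (n (S + L) + 1),
          Set.Icc (Real.exp (t i - L)) (Real.exp (t i + L))) :=
        MeasureTheory.lintegral_mono_set hcover
    _ ≤ ∑' i : Fin (n (S + L) + 1),
          logMeasure (Set.Icc (Real.exp (t i - L)) (Real.exp (t i + L))) :=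
        MeasureTheory.lintegral_iUnion_le _ _
    _ = ∑' i : Fin (n (S + L) + 1), ENNReal.ofReal (2 * L) := by
        refine tsum_congr fun i => ?_
        rw [logMeasure_Icc_exp (by linarith)]
        congr 1
        ring
    _ = _ := by
        rw [tsum_fintype, Finset.sum_const, Finset.card_univ, Fintype.card_fin, nsmul_eq_mul,
          ← Nat.cast_succ, ENNReal.ofReal_mul (Nat.cast_nonneg _), ENNReal.ofReal_natCast]

lemma rpow_neg_one_sub_mul_self {S : ℝ} (hS : 0 < S) (c : ℝ) : S ^ (-(1 - c)) * S = S ^ c := by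
  nth_rewrite 2 [← Real.rpow_one S]
  rw [← Real.rpow_add hS]
  congr 1
  ring

/-- If `n` grows at most like `s ^ α`, the jump set has logarithmic measure `O(S ^ (α + γ))` up to
`e ^ S`, which is `o(S)`. -/
lemma logDensity_jumpSet {n : ℝ → ℕ} (hn : Monotone n) {α γ : ℝ} (hα : 0 ≤ α) (hγ : 0 < γ)
    (hαγ : α + γ < 1) (hle : ∀ᶠ s : ℝ in atTop, (n s : ℝ) ≤ (3 * s) ^ α) :
    logDensity (jumpSet n γ) = 0 := by
  have hlim : Tendsto (fun S : ℝ => 2 * 6 ^ α * S ^ (-(1 - (α + γ))) + 2 * S ^ (-(1 - γ)))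
      atTop (𝓝 0) := by
    simpa using ((tendsto_rpow_neg_atTop (by linarith : 0 < 1 - (α + γ))).const_mul
      (2 * (6 : ℝ) ^ α)).add ((tendsto_rpow_neg_atTop (by linarith : 0 < 1 - γ)).const_mul 2)
  have hlim' := ENNReal.tendsto_ofReal (hlim.comp Real.tendsto_log_atTop)
  rw [ENNReal.ofReal_zero] at hlim'
  refine Tendsto.limsup_eq (tendsto_of_tendsto_of_tendsto_of_le_of_le' tendsto_const_nhds hlim'
    (Eventually.of_forall fun _ => zero_le) ?_)
  obtain ⟨s₀, hs₀⟩ := eventually_atTop.1 hle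
  filter_upwards [Real.tendsto_log_atTop.eventually_ge_atTop (max s₀ 1)] with R hR
  set S := Real.log R
  have hS1 : 1 ≤ S := (le_max_right _ _).trans hR
  have hS : 0 < S := by linarith
  have hL : 0 ≤ S ^ γ := Real.rpow_nonneg hS.le γ
  have hLS : S ^ γ ≤ S := by
    simpa using Real.rpow_le_rpow_of_exponent_le hS1 (by linarith : γ ≤ 1)
  have h1 : (n (S + S ^ γ) : ℝ) ≤ (6 * S) ^ α :=
    (hs₀ _ (by linarith [(le_max_left s₀ 1).trans hR])).trans
      (Real.rpow_le_rpow (by positivity) (by linarith) hα)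
  refine (ENNReal.div_le_div_right (logMeasure_jumpSet_le hn hγ) _).trans ?_
  rw [← ENNReal.ofReal_div_of_pos hS]
  refine ENNReal.ofReal_le_ofReal ?_
  change _ ≤ 2 * 6 ^ α * S ^ (-(1 - (α + γ))) + 2 * S ^ (-(1 - γ))
  have e1 : S ^ (-(1 - (α + γ))) * S = S ^ α * S ^ γ := by
    rw [rpow_neg_one_sub_mul_self hS, Real.rpow_add hS]
  have e2 := rpow_neg_one_sub_mul_self hS γ
  rw [Real.mul_rpow (by norm_num) hS.le] at h1
  rw [div_le_iff₀ hS]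
  have h2 := mul_le_mul_of_nonneg_right h1 hL
  calc _ ≤ 2 * (6 ^ α * (S ^ α * S ^ γ) + S ^ γ) := by linarith
    _ = _ := by linear_combination -2 * 6 ^ α * e1 - 2 * e2

/-! ### Terms away from the central index -/

lemma factor_le (hq : 0 < q) (hq1 : q < 1) {r' : ℝ} {j : ℕ} (hr : 0 < r) (hr' : 0 < r')
    (h : 1 ≤ r * q ^ j) :
    1 + 2 * r * q ^ j + q ^ (2 * j) ≤ 2 * (r / r') * (1 + 2 * r' * q ^ j + q ^ (2 * j)) := by
  have h1 : q ^ (2 * j) ≤ 1 := pow_le_one₀ hq.le hq1.le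
  have h2 : 0 ≤ 2 * (r / r') * (1 + q ^ (2 * j)) := by positivity
  have h3 : 2 * (r / r') * (2 * r' * q ^ j) = 4 * (r * q ^ j) := by
    field_simp
    ring
  linarith

/-- When the central index is the same at `e ^ (s - L)`, `e ^ s` and `e ^ (s + L)`, the terms at
`e ^ s` decay like `(2 e ^ (-L)) ^ |k - N|`, as long as `e ^ s q ^ k ≥ 1`. -/
lemma termMax_le_pow (hq : 0 < q) (hq1 : q < 1) (hd : SuperGaussianDecay a)
    (hne : ∃ k, a k ≠ 0) {s L : ℝ} {N : ℕ}
    (hN : centralIndex q a (Real.exp s) = N) (hleft : centralIndex q a (Real.exp (s - L)) = N)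
    (hright : centralIndex q a (Real.exp (s + L)) = N) (hNs : 1 ≤ Real.exp (s - L) * q ^ N)
    (k : ℕ) (hk : k ≤ N ∨ 1 ≤ Real.exp s * q ^ k) :
    termMax q a (Real.exp s) k ≤
      (2 * Real.exp (-L)) ^ ((k - N) + (N - k)) * maxTerm q a (Real.exp s) := by
  have hmax := (centralIndex_spec hq hq1 hd hne (Real.exp_pos s).le).1
  rw [hN] at hmax
  rw [← hmax]
  have hmono : ∀ {i j : ℕ}, i ≤ j → q ^ j ≤ q ^ i := fun h => pow_le_pow_of_le_one hq.le hq1.le h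
  have hc : 0 ≤ 2 * Real.exp (-L) := by positivity
  have e1 : Real.exp (-L) = Real.exp s / Real.exp (s + L) := by
    rw [← Real.exp_sub]; congr 1; ring
  have e2 : Real.exp (-L) = Real.exp (s - L) / Real.exp s := by
    rw [← Real.exp_sub]; congr 1; ring
  rcases le_total k N with hkN | hNk
  · rw [Nat.sub_eq_zero_of_le hkN, zero_add]
    refine termMax_le_of_ge hq hkN (Real.exp_pos s).le (Real.exp_pos (s - L)).le hc
      (fun j _ hj => ?_)
      (hleft ▸ termMax_le_centralIndex hq hq1 hd hne (Real.exp_pos (s - L)).le k)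
    rw [e2]
    refine factor_le hq hq1 (Real.exp_pos _) (Real.exp_pos _) (hNs.trans ?_)
    exact mul_le_mul_of_nonneg_left (hmono hj.le) (Real.exp_pos _).le
  · rw [Nat.sub_eq_zero_of_le hNk, add_zero]
    refine termMax_le_of_le hq hNk (Real.exp_pos s).le (Real.exp_pos (s + L)).le hc
      (fun j _ hj => ?_)
      (hright ▸ termMax_le_centralIndex hq hq1 hd hne (Real.exp_pos (s + L)).le k)
    rw [e1]
    rcases hk with hk | hk
    · omega
    refine factor_le hq hq1 (Real.exp_pos _) (Real.exp_pos _) (hk.trans ?_)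
    exact mul_le_mul_of_nonneg_left (hmono hj.le) (Real.exp_pos _).le

/-- For the indices with `e ^ s q ^ k < 1` the decay of the coefficients alone suffices. -/
lemma eventually_weight_mul_termMax_le (hq : 0 < q) (hq1 : q < 1) (hd : SuperGaussianDecay a)
    {h : ℝ} (hh : 0 ≤ h) {c : ℝ} (hc : 0 < c) :
    ∀ᶠ k : ℕ in atTop, ∀ s : ℝ, 0 ≤ s → Real.exp s * q ^ k < 1 →
      q ^ (-(h * (k : ℝ))) * termMax q a (Real.exp s) k ≤ c * Real.exp (-(k : ℝ)) := by
  set l := -Real.log q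
  have hl : 0 < l := neg_pos.2 (Real.log_neg hq hq1)
  filter_upwards [hd (l + 3 + h * l + |Real.log c|), eventually_ge_atTop 1] with k hk h1 s hs hlt
  have h1 : (1 : ℝ) ≤ k := by exact_mod_cast h1
  have hqk : q ^ k = Real.exp (-(k * l)) := pow_eq_exp hq k
  rw [hqk, ← Real.exp_add, Real.exp_lt_one_iff] at hlt
  have e1 : q ^ (-(h * (k : ℝ))) = Real.exp (h * l * k) := by
    rw [Real.rpow_def_of_pos hq]
    congr 1
    simp only [l]
    ring
  have e2 : (2 + 2 * Real.exp s) ^ k ≤ Real.exp (k * (s + 2)) := by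
    rw [Real.exp_nat_mul]
    exact pow_le_pow_left₀ (by positivity) (two_add_two_mul_exp_le hs) _
  have h2 : termMax q a (Real.exp s) k ≤
      Real.exp (-((l + 3 + h * l + |Real.log c|) * (k : ℝ) ^ 2)) * Real.exp (k * (s + 2)) :=
    (termMax_le hq hq1 (Real.exp_pos s).le k).trans
      (mul_le_mul hk e2 (by positivity) (Real.exp_pos _).le)
  rw [e1]
  refine (mul_le_mul_of_nonneg_left h2 (Real.exp_pos _).le).trans ?_
  rw [show c * Real.exp (-(k : ℝ)) = Real.exp (Real.log c + -(k : ℝ)) by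
    rw [Real.exp_add, Real.exp_log hc], ← Real.exp_add, ← Real.exp_add, Real.exp_le_exp]
  have h3 := neg_abs_le (Real.log c)
  have h4 := abs_nonneg (Real.log c)
  have h5 : (k : ℝ) ≤ (k : ℝ) ^ 2 := by nlinarith
  have h6 : 1 ≤ (k : ℝ) ^ 2 := by linarith
  have h7 : (k : ℝ) * s ≤ l * (k : ℝ) ^ 2 := by nlinarith
  have h8 := mul_le_mul_of_nonneg_left h5 (mul_nonneg hh hl.le)
  have h9 := mul_le_mul_of_nonneg_left h6 h4
  linarith

/-- Off the jump set the weighted terms decay exponentially in `|k - N|`, relative to the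
weighted maximal term. -/
lemma eventually_weightedTerm_le (hq : 0 < q) (hq1 : q < 1) (hd : SuperGaussianDecay a)
    (hne : ∀ n, ∃ k, n < k ∧ a k ≠ 0) {α γ : ℝ} (hα : α < 1) (hγ : 0 < γ) (hγ1 : γ < 1)
    (hle : ∀ᶠ s : ℝ in atTop, (centralIndex q a (Real.exp s) : ℝ) ≤ (3 * s) ^ α)
    {h : ℝ} (hh : 0 ≤ h) :
    ∀ᶠ s : ℝ in atTop, centralIndex q a (Real.exp (s + s ^ γ)) =
        centralIndex q a (Real.exp (s - s ^ γ)) → ∀ k : ℕ,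
      weightedTerm q a h (Real.exp s) k ≤
        maxTerm q a (Real.exp s) * q ^ (-(h * (centralIndex q a (Real.exp s) : ℝ))) *
          qNumber q (centralIndex q a (Real.exp s)) ^ h * (1 / (1 - q)) ^ h *
          Real.exp (-|(k : ℝ) - centralIndex q a (Real.exp s)|) := by
  obtain ⟨k₀, -, hk₀⟩ := hne 0
  have hne' : ∃ k, a k ≠ 0 := ⟨k₀, hk₀⟩
  set l := -Real.log q
  have hl : 0 < l := neg_pos.2 (Real.log_neg hq hq1)
  obtain ⟨K, hK⟩ := eventually_atTop.1
    (eventually_weight_mul_termMax_le hq hq1 hd hh (norm_pos_iff.2 hk₀))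
  have hqk : ∀ k : ℕ, q ^ k = Real.exp (-(k * l)) := pow_eq_exp hq
  have hsmall : ∀ᶠ s : ℝ in atTop, 3 ^ α * l * s ^ (-(1 - α)) + s ^ (-(1 - γ)) < 1 := by
    have := ((tendsto_rpow_neg_atTop (by linarith : 0 < 1 - α)).const_mul
      ((3 : ℝ) ^ α * l)).add (tendsto_rpow_neg_atTop (by linarith : 0 < 1 - γ))
    rw [mul_zero, add_zero] at this
    exact this.eventually (gt_mem_nhds one_pos)
  filter_upwards [hle, hsmall,
    (tendsto_rpow_atTop hγ).eventually_ge_atTop (Real.log 2 + h * l + 1),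
    ((tendsto_centralIndex hq hq1 hd hne).comp Real.tendsto_exp_atTop).eventually_ge_atTop 1,
    eventually_ge_atTop (K * l), eventually_gt_atTop 0] with s hsN hs1 hsL hN1 hsK hs0 heq k
  set N := centralIndex q a (Real.exp s)
  set L := s ^ γ
  have hL : 0 ≤ L := Real.rpow_nonneg hs0.le γ
  -- Both `N` and `L` are `o(s)`, so `e ^ (s - L) q ^ N ≥ 1`.
  have hNl : N * l ≤ s - L := by
    have e1 := rpow_neg_one_sub_mul_self hs0 α
    have e2 : s ^ (-(1 - γ)) * s = L := rpow_neg_one_sub_mul_self hs0 γ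
    rw [Real.mul_rpow (by norm_num) hs0.le] at hsN
    have h1 := mul_le_mul_of_nonneg_right hsN hl.le
    have h2 := mul_lt_mul_of_pos_right hs1 hs0
    rw [← e1] at h1
    nlinarith
  have hNs : 1 ≤ Real.exp (s - L) * q ^ N := by
    rw [hqk, ← Real.exp_add]
    exact Real.one_le_exp (by linarith)
  have hm1 : centralIndex q a (Real.exp (s - L)) ≤ N :=
    centralIndex_mono hq hq1 hd hne' (Real.exp_pos _).le (Real.exp_le_exp.2 (by linarith))
  have hm2 : N ≤ centralIndex q a (Real.exp (s + L)) :=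
    centralIndex_mono hq hq1 hd hne' (Real.exp_pos _).le (Real.exp_le_exp.2 (by linarith))
  have hr := (Real.exp_pos s).le
  obtain ⟨-, hspec, -⟩ := centralIndex_spec hq hq1 hd hne' hr
  set μ := maxTerm q a (Real.exp s)
  have hμ : ‖a k₀‖ ≤ μ := by
    refine le_trans ?_ (hspec k₀)
    rw [termMax_eq hq hr]
    exact le_mul_of_one_le_right (norm_nonneg _) (one_le_basisMax hq hr k₀)
  have hμ0 : 0 ≤ μ := (norm_nonneg _).trans hμ
  set D := (1 / (1 - q)) ^ h
  have hD : 0 ≤ D := Real.rpow_nonneg (one_div_nonneg.2 (by linarith)) h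
  have hkD : qNumber q k ^ h ≤ D :=
    Real.rpow_le_rpow (qNumber_nonneg hq hq1 k) (qNumber_le hq hq1 k) hh
  have hkD0 : 0 ≤ qNumber q k ^ h := Real.rpow_nonneg (qNumber_nonneg hq hq1 k) h
  have hND : 1 ≤ qNumber q N ^ h :=
    Real.one_le_rpow (one_le_qNumber hq hq1 (Nat.one_le_iff_ne_zero.1 hN1)) hh
  have hrpow : ∀ x : ℝ, q ^ (-(h * x)) = Real.exp (h * l * x) := fun x => by
    rw [Real.rpow_def_of_pos hq]
    congr 1
    simp only [l]
    ring
  suffices hmain : q ^ (-(h * (k : ℝ))) * termMax q a (Real.exp s) k ≤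
      μ * q ^ (-(h * (N : ℝ))) * Real.exp (-|(k : ℝ) - N|) by
    rw [weightedTerm_eq hq hr]
    have hnn : 0 ≤ μ * q ^ (-(h * (N : ℝ))) * Real.exp (-|(k : ℝ) - N|) := by positivity
    calc q ^ (-(h * (k : ℝ))) * qNumber q k ^ h * termMax q a (Real.exp s) k
        = q ^ (-(h * (k : ℝ))) * termMax q a (Real.exp s) k * qNumber q k ^ h := by ring
      _ ≤ μ * q ^ (-(h * (N : ℝ))) * Real.exp (-|(k : ℝ) - N|) * D :=
          mul_le_mul hmain hkD hkD0 hnn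
      _ ≤ μ * q ^ (-(h * (N : ℝ))) * Real.exp (-|(k : ℝ) - N|) * D * qNumber q N ^ h :=
          le_mul_of_one_le_right (mul_nonneg hnn hD) hND
      _ = _ := by ring
  by_cases hk : k ≤ N ∨ 1 ≤ Real.exp s * q ^ k
  -- The exponent `(k - N) + (N - k)` of truncated differences equals `|k - N|`.
  · have h1 := termMax_le_pow hq hq1 hd hne' rfl (by omega) (by omega) hNs k hk
    have hcast : (((k - N) + (N - k) : ℕ) : ℝ) = |(k : ℝ) - N| := by
      rcases le_total k N with hkN | hNk
      · rw [Nat.sub_eq_zero_of_le hkN, zero_add, Nat.cast_sub hkN, abs_sub_comm,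
          abs_of_nonneg (sub_nonneg.2 (by exact_mod_cast hkN))]
      · rw [Nat.sub_eq_zero_of_le hNk, add_zero, Nat.cast_sub hNk,
          abs_of_nonneg (sub_nonneg.2 (by exact_mod_cast hNk))]
    have h2 : (2 * Real.exp (-L)) ^ ((k - N) + (N - k)) =
        Real.exp (|(k : ℝ) - N| * (Real.log 2 - L)) := by
      rw [← hcast, Real.exp_nat_mul, sub_eq_add_neg, Real.exp_add, Real.exp_log two_pos]
    rw [h2] at h1
    rw [hrpow, hrpow]
    refine (mul_le_mul_of_nonneg_left h1 (Real.exp_pos _).le).trans ?_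
    have h3 : Real.exp (h * l * k) * Real.exp (|(k : ℝ) - N| * (Real.log 2 - L)) ≤
        Real.exp (h * l * N) * Real.exp (-|(k : ℝ) - N|) := by
      rw [← Real.exp_add, ← Real.exp_add, Real.exp_le_exp]
      have h4 := le_abs_self ((k : ℝ) - N)
      have h5 := mul_le_mul_of_nonneg_left h4 (mul_nonneg hh hl.le)
      have h6 := mul_le_mul_of_nonneg_left hsL (abs_nonneg ((k : ℝ) - N))
      linarith
    have h7 := mul_le_mul_of_nonneg_left h3 hμ0
    linarith
  -- Here `e ^ s q ^ k < 1`, hence `k > s / l ≥ K`.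
  · push Not at hk
    obtain ⟨hNk, hlt⟩ := hk
    have hkK : K ≤ k := by
      rw [hqk, ← Real.exp_add, Real.exp_lt_one_iff] at hlt
      have : (K : ℝ) < k := lt_of_mul_lt_mul_right (by linarith : (K : ℝ) * l < k * l) hl.le
      exact_mod_cast this.le
    refine (hK k hkK s hs0.le hlt).trans ?_
    have hNk' : (N : ℝ) ≤ k := by exact_mod_cast hNk.le
    refine mul_le_mul (hμ.trans (le_mul_of_one_le_right hμ0 ?_)) ?_ (Real.exp_pos _).le
      (by positivity)
    · rw [hrpow]
      exact Real.one_le_exp (by positivity)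
    · rw [abs_of_nonneg (by linarith), Real.exp_le_exp]
      linarith [(Nat.cast_nonneg N : (0 : ℝ) ≤ N)]

/-! ### The tail sum -/

lemma summable_exp_neg_abs_int : Summable fun z : ℤ => Real.exp (-(|(z : ℝ)| / 2)) := by
  have h : Summable fun n : ℕ => Real.exp (-((n : ℝ) / 2)) := by
    refine (Real.summable_exp_nat_mul_iff.2 (by norm_num : (-1 / 2 : ℝ) < 0)).congr fun n => ?_
    congr 1
    ring
  exact Summable.of_nat_of_neg (by simpa using h) (by simpa using h)

/-- Half of the exponent `|k - N|` provides the factor `exp (-K / 2)`, the other half is summed. -/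
lemma tsum_farIndices_le {u : ℕ → ℝ} {N K : ℕ} {Q : ℝ} (hu : Summable u)
    (hQ : 0 ≤ Q) (h : ∀ k, u k ≤ Q * Real.exp (-|(k : ℝ) - N|)) :
    ∑' k : farIndices N K, u k ≤
      Q * Real.exp (-((K : ℝ) / 2)) * ∑' z : ℤ, Real.exp (-(|(z : ℝ)| / 2)) := by
  rw [← tsum_mul_left]
  refine Summable.tsum_le_tsum_of_inj (fun k : farIndices N K => ((k : ℕ) : ℤ) - N) ?_
    (fun z _ => by positivity) (fun k => ?_) (hu.subtype _) (summable_exp_neg_abs_int.mul_left _)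
  · intro i j hij
    have : ((i : ℕ) : ℤ) - N = ((j : ℕ) : ℤ) - N := hij
    exact Subtype.ext (by omega)
  · refine (h k).trans ?_
    rw [mul_assoc, ← Real.exp_add]
    refine mul_le_mul_of_nonneg_left (Real.exp_le_exp.2 ?_) hQ
    have hk : (K : ℤ) ≤ |((k : ℕ) : ℤ) - N| := k.2
    have hk' : (K : ℝ) ≤ |((k : ℕ) : ℝ) - N| := by exact_mod_cast hk
    push_cast
    linarith

/-- `κ` grows at least like `√β N ^ ((1 - δ) / 2)`, so `exp (-κ / 2)` beats any power of `N`. -/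
lemma eventually_exp_neg_kappa_le {δ β : ℝ} (hδ1 : δ < 1) (hβ : 0 < β) (ω : ℝ) {ε : ℝ}
    (hε : 0 < ε) : ∀ᶠ N : ℕ in atTop,
      Real.exp (-((kappa δ β N : ℝ) / 2)) ≤ ε * bFun δ N ^ ((ω - 1) / 2) := by
  have hδ : 0 < 1 - δ := by linarith
  have hx : Tendsto (fun N : ℕ => (N : ℝ) ^ ((1 - δ) / 2)) atTop atTop :=
    (tendsto_rpow_atTop (by linarith)).comp tendsto_natCast_atTop_atTop
  have hlim := (tendsto_rpow_mul_exp_neg_mul_atTop_nhds_zero (ω - 1) (Real.sqrt β / 2)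
    (by positivity)).comp hx
  have hpos : 0 < ε * Real.exp (-(1 / 2)) := by positivity
  have hlog : Tendsto (fun N : ℕ => (1 - δ) * Real.log N) atTop atTop :=
    (Real.tendsto_log_atTop.comp tendsto_natCast_atTop_atTop).const_mul_atTop hδ
  filter_upwards [hlim.eventually (gt_mem_nhds hpos), hlog.eventually_ge_atTop 1,
    eventually_gt_atTop 0] with N hN hlogN hN0
  have hN0 : (0 : ℝ) < N := by exact_mod_cast hN0
  have hN : ((N : ℝ) ^ ((1 - δ) / 2)) ^ (ω - 1) *
      Real.exp (-(Real.sqrt β / 2) * (N : ℝ) ^ ((1 - δ) / 2)) < ε * Real.exp (-(1 / 2)) := hN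
  set x := (N : ℝ) ^ ((1 - δ) / 2)
  have hx0 : 0 < x := Real.rpow_pos_of_pos hN0 _
  have hb : bFun δ N = x⁻¹ ^ 2 := by
    rw [bFun, inv_pow, ← Real.rpow_natCast x, ← Real.rpow_mul hN0.le, ← Real.rpow_neg hN0.le]
    congr 1
    push_cast
    ring
  have hbinv : 1 / bFun δ N = x ^ 2 := by
    rw [hb, inv_pow, one_div, inv_inv]
  have hlogb : Real.log (1 / bFun δ N) = (1 - δ) * Real.log N := by
    rw [bFun, one_div, Real.log_inv, Real.log_rpow hN0]
    ring
  have hkap : Real.sqrt β * x - 1 ≤ kappa δ β N := by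
    have h1 : Real.sqrt β * x ≤
        Real.sqrt (β / bFun δ N * Real.log (1 / bFun δ N)) := by
      rw [hlogb, div_eq_mul_one_div, hbinv]
      refine Real.le_sqrt_of_sq_le ?_
      rw [mul_pow, Real.sq_sqrt hβ.le]
      exact le_mul_of_one_le_right (by positivity) hlogN
    have h2 := Nat.lt_floor_add_one
      (Real.sqrt (β / bFun δ N * Real.log (1 / bFun δ N)))
    have h3 : (kappa δ β N : ℝ) =
      (⌊Real.sqrt (β / bFun δ N * Real.log (1 / bFun δ N))⌋₊ : ℝ) := rfl
    linarith
  have hbpow : bFun δ N ^ ((ω - 1) / 2) = (x ^ (ω - 1))⁻¹ := by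
    rw [hb, ← Real.rpow_natCast, ← Real.rpow_mul (by positivity), Real.inv_rpow hx0.le]
    congr 2
    push_cast
    ring
  rw [hbpow, ← div_eq_mul_inv, le_div_iff₀ (Real.rpow_pos_of_pos hx0 _)]
  calc Real.exp (-((kappa δ β N : ℝ) / 2)) * x ^ (ω - 1)
      ≤ Real.exp (1 / 2 + -(Real.sqrt β / 2) * x) * x ^ (ω - 1) := by
        refine mul_le_mul_of_nonneg_right (Real.exp_le_exp.2 ?_)
          (Real.rpow_pos_of_pos hx0 _).le
        linarith
    _ = Real.exp (1 / 2) * (x ^ (ω - 1) * Real.exp (-(Real.sqrt β / 2) * x)) := by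
        rw [Real.exp_add]; ring
    _ ≤ Real.exp (1 / 2) * (ε * Real.exp (-(1 / 2))) :=
        mul_le_mul_of_nonneg_left hN.le (Real.exp_pos _).le
    _ = ε := by
        rw [mul_left_comm, ← Real.exp_add]; simp

end AskeyWilson

open AskeyWilson in
theorem theorem3p1 (q : ℝ) (hq0 : 0 < q) (hq1 : q < 1)
    (f : ℂ → ℂ) (hf : AskeyWilson.IsTranscendentalEntire f)
    (hord : AskeyWilson.logOrder f < 2)
    (a : ℕ → ℂ) (ha : AskeyWilson.IsExpansion q a f)
    (δ : ℝ) (hδ0 : 0 < δ) (hδ1 : δ < 1) :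
    ∃ E : Set ℝ, E ⊆ Set.Ici 1 ∧ MeasurableSet E ∧ AskeyWilson.logDensity E = 0 ∧
      ∀ h β ω : ℝ, 0 ≤ h → 0 < β → 0 < ω → ω < β →
        (∀ r : ℝ, 0 < r → Summable (fun k : ℕ => AskeyWilson.weightedTerm q a h r k)) ∧
        (fun r : ℝ =>
            ∑' k : AskeyWilson.farIndices (AskeyWilson.centralIndex q a r)
                (AskeyWilson.kappa δ β (AskeyWilson.centralIndex q a r)),
              AskeyWilson.weightedTerm q a h r (k : ℕ))
          =o[atTop ⊓ 𝓟 (Set.Ioi 0 \ E)]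
        (fun r : ℝ =>
            AskeyWilson.maxTerm q a r
              * q ^ (-(h * (AskeyWilson.centralIndex q a r : ℝ)))
              * AskeyWilson.qNumber q (AskeyWilson.centralIndex q a r) ^ h
              * AskeyWilson.bFun δ (AskeyWilson.centralIndex q a r) ^ ((ω - 1) / 2)) := by
  obtain ⟨τ, hτ, hdec⟩ := exists_coeff_decay hq0 hq1 hf.1 hord ha
  have hd := superGaussianDecay_of_le hτ hdec
  have hne := exists_coeff_ne_zero hf ha
  have hne' : ∃ k, a k ≠ 0 := (hne 0).imp fun _ h => h.2
  have hα0 : 0 < 1 / τ := by positivity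
  have hα1 : 1 / τ < 1 := (div_lt_one (by linarith)).2 hτ
  have hle := centralIndex_le (q := q) hq0 hq1 hne' hτ hdec
  set γ := (1 - 1 / τ) / 2
  have hγ : 0 < γ := half_pos (by linarith)
  have hαγ : 1 / τ + γ < 1 := by simp only [γ]; linarith
  have hmono : Monotone fun s : ℝ => centralIndex q a (Real.exp s) := fun s t hst =>
    centralIndex_mono hq0 hq1 hd hne' (Real.exp_pos s).le (Real.exp_le_exp.2 hst)
  refine ⟨jumpSet (fun s : ℝ => centralIndex q a (Real.exp s)) γ, fun r hr => hr.1,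
    measurableSet_jumpSet hmono γ, logDensity_jumpSet hmono hα0.le hγ hαγ hle,
    fun h β ω hh hβ _ _ => ⟨fun r hr => summable_weightedTerm hq0 hq1 hd hh hr.le, ?_⟩⟩
  rw [isLittleO_iff]
  intro ε hε
  rw [eventually_inf_principal]
  set D := (1 / (1 - q)) ^ h
  have hD : 0 < D := Real.rpow_pos_of_pos (one_div_pos.2 (by linarith)) h
  set C := ∑' z : ℤ, Real.exp (-(|(z : ℝ)| / 2))
  have hC : 0 < C := summable_exp_neg_abs_int.tsum_pos (fun z => (Real.exp_pos _).le) 0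
    (Real.exp_pos _)
  filter_upwards [Real.tendsto_log_atTop.eventually
      (eventually_weightedTerm_le hq0 hq1 hd hne hα1 hγ (by linarith) hle hh),
    (tendsto_centralIndex hq0 hq1 hd hne).eventually
      (eventually_exp_neg_kappa_le hδ1 hβ ω (by positivity : 0 < ε / (D * C))),
    eventually_ge_atTop 1] with r hterm hkap hr1 hrE
  have hr0 : 0 < r := by linarith
  have hjump : centralIndex q a (Real.exp (Real.log r + Real.log r ^ γ)) =
      centralIndex q a (Real.exp (Real.log r - Real.log r ^ γ)) := by
    by_contra hcon
    exact hrE.2 ⟨hr1, hcon⟩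
  have hterm := hterm hjump
  rw [Real.exp_log hr0] at hterm
  obtain ⟨hspec, -, -⟩ := centralIndex_spec hq0 hq1 hd hne' hr0.le
  have hμ : 0 ≤ maxTerm q a r := hspec ▸ termMax_nonneg hq0 hr0.le _
  set N := centralIndex q a r
  set Q := maxTerm q a r * q ^ (-(h * (N : ℝ))) * qNumber q N ^ h
  have hQ : 0 ≤ Q := mul_nonneg (mul_nonneg hμ (Real.rpow_nonneg hq0.le _))
    (Real.rpow_nonneg (qNumber_nonneg hq0 hq1 N) h)
  have hb : 0 ≤ bFun δ N ^ ((ω - 1) / 2) :=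
    Real.rpow_nonneg (Real.rpow_nonneg (Nat.cast_nonneg N) _) _
  rw [Real.norm_of_nonneg (tsum_nonneg fun k : farIndices N (kappa δ β N) =>
      weightedTerm_nonneg hq0 hq1 h r k), Real.norm_of_nonneg (mul_nonneg hQ hb)]
  refine (tsum_farIndices_le
    (summable_weightedTerm hq0 hq1 hd hh hr0.le) (mul_nonneg hQ hD.le) hterm).trans ?_
  calc Q * D * Real.exp (-((kappa δ β N : ℝ) / 2)) * C
      = Q * (D * C) * Real.exp (-((kappa δ β N : ℝ) / 2)) := by ring
    _ ≤ Q * (D * C) * (ε / (D * C) * bFun δ N ^ ((ω - 1) / 2)) :=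
        mul_le_mul_of_nonneg_left hkap (by positivity)
    _ = ε * (Q * bFun δ N ^ ((ω - 1) / 2)) := by
        field_simp
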